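/- Let $E=\mathbb R^d$ and let $(X_{n,i})_{1\le i\le n,\,n\ge1}$ be a row-wise stationary triangular scheme of $E$-valued random vectors on a probability space $(\Omega,P)$. Let $1\le r_n\le n$ be integers, $m_n=\lfloor n/r_n\rfloor$, $v_n=P\{X_{n,1}\neq0\}>0$, and let $Y_{n,j}=(X_{n,i})_{(j-1)r_n<i\le jr_n}$, $1\le j\le m_n$, be the corresponding blocks; $Y_n$ denotes a generic block. Let $(\xi_j)_{j\ge1}$ be i.i.d. real random variables with mean $0$ and variance $1$ on a second probability space $(\Xi,Q)$. All variables are regarded as defined on the product space $(\Omega\times\Xi,P\otimes Q)$, and $E_\xi$ denotes integration with respect to $Q$ only, the data being held fixed. Let $\mathcal F$ be a family of cluster functionals, i.e. of measurable functions $f:\bigcup_l E^l\to\mathbb R$ that vanish at zero vectors and whose value does not change if arbitrarily many zeros are added at the beginning and at the end of the argument. Assume $E|f(Y_n)|<\infty$ for all $f\in\mathcal F$ and $n\ge 1$, and put $$Z_{n,\xi}(f)=\frac1{\sqrt{nv_n}}\sum_{j=1}^{m_n}\xi_j\bigl(f(Y_{n,j})-Ef(Y_{n,j})\bigr),\qquad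 f\in\mathcal F.$$ Assume that all sample paths of $Z_{n,\xi}$ belong to the space $\ell^\infty(\mathcal F)$ of bounded functions on $\mathcal F$ with the supremum norm. Let $Z$ be a tight Borel random element of $\ell^\infty(\mathcal F)$. For a normed space $V$ let $BL_1(V)$ be the set of all $g:V\to\mathbb R$ with $|g|\le1$ and $|g(z)-g(w)|\le\|z-w\|$ for all $z,w\in V$; on $\mathbb R^l$ the maximum norm is used. Suppose that 1. (Condition (D3)) there is a semi-metric $\rho$ on $\mathcal F$ such that $\mathcal F$ is totally bounded with respect to $\rho$ and $$\lim_{\delta\downarrow0}\ \limsup_{n\to\infty}\ \sup_{f,g\in\mathcal F,\ \rho(f,g)<\delta}\frac1{r_nv_n}E\bigl(f(Y_n)-g(Y_n)\bigr)^2=0;$$ 2. for all $l$ and all $f_1,\dots,f_l\in\mathcal F$, $$\sup_{g\in BL_1(\mathbb R^l)}\Bigl|E_\xi g\bigl((Z_{n,\xi}(f_k))_{1\le k\le l}\bigr)-Eg\bigl((Z(f_k))_{1\le k\le l}\bigr)\Bigr|\longrightarrow0\quad\text{in probability};$$ 3. $Z_{n,\xi}$ converges weakly to $Z$ in $\ell^\infty(\mathcal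 F)$ (unconditionally), i.e. $E^*h(Z_{n,\xi})\to Eh(Z)$ for every bounded continuous $h:\ell^\infty(\mathcal F)\to\mathbb R$, where $E^*$ is the outer expectation on $\Omega\times\Xi$. Then $$\sup_{g\in BL_1(\ell^\infty(\mathcal F))}\bigl|E_\xi g(Z_{n,\xi})-Eg(Z)\bigr|\longrightarrow0\quad\text{in outer probability.}$$ -/

import Mathlib

open MeasureTheory ProbabilityTheory Filter Topology
open scoped ENNReal BoundedContinuousFunction

namespace MultiplierBootstrap

/-- The state space `ℝ^d`. -/
abbrev State (d : ℕ) : Type := Fin d → ℝ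

/-- Cluster functionals. Vectors of arbitrary length over `ℝ^d` are lists; a function of such vectors
is measurable for the σ-field induced by the Borel σ-fields of the `(ℝ^d)^l` iff its restriction to
every `(ℝ^d)^l` is. (The value at the empty list is forced to be `0`, so admitting it is harmless.) -/
structure IsClusterFunctional {d : ℕ} (f : List (State d) → ℝ) : Prop where
  measurable : ∀ l : ℕ, Measurable fun y : Fin l → State d => f (List.ofFn y)
  zero : ∀ l : ℕ, f (List.replicate l 0) = 0
  core : ∀ (a b : ℕ) (y : List (State d)), f (List.replicate a 0 ++ y ++ List.replicate b 0) = f y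

/-- `X n i`, `0 ≤ i < n`, is a row-wise stationary triangular scheme of random vectors
(`X n i` is the entry usually written `X_{n,i+1}`; entries with `i ≥ n` are irrelevant). -/
structure IsRowStationary {d : ℕ} {Ω : Type*} [MeasurableSpace Ω] (P : Measure Ω)
    (X : ℕ → ℕ → Ω → State d) : Prop where
  measurable : ∀ n i : ℕ, i < n → Measurable (X n i)
  stationary : ∀ n h k : ℕ, h + k ≤ n →
    IdentDistrib (fun ω (i : Fin k) => X n (h + i) ω) (fun ω (i : Fin k) => X n i ω) P P

/-- The multipliers: i.i.d. real random variables with mean `0` and variance `1`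
(`ξ j` is the variable usually written `ξ_{j+1}`). -/
structure IsMultiplierSequence {Ξ : Type*} [MeasurableSpace Ξ] (Q : Measure Ξ)
    (ξ : ℕ → Ξ → ℝ) : Prop where
  measurable : ∀ j, Measurable (ξ j)
  indep : iIndepFun ξ Q
  identDistrib : ∀ j, IdentDistrib (ξ j) (ξ 0) Q Q
  memLp : ∀ j, MemLp (ξ j) 2 Q
  mean : ∀ j, ∫ x, ξ j x ∂Q = 0
  var : ∀ j, variance (ξ j) Q = 1

/-- The `j`-th block (`j = 0, 1, …`) of length `r n` of the `n`-th row. -/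
def block {d : ℕ} {Ω : Type*} (X : ℕ → ℕ → Ω → State d) (r : ℕ → ℕ) (n j : ℕ) (ω : Ω) :
    List (State d) :=
  List.ofFn fun i : Fin (r n) => X n (j * r n + i) ω

/-- `v_n`, the probability that the first entry of the `n`-th row does not vanish. -/
noncomputable def nonzeroProb {d : ℕ} {Ω : Type*} [MeasurableSpace Ω] (P : Measure Ω)
    (X : ℕ → ℕ → Ω → State d) (n : ℕ) : ℝ :=
  P.real {ω | X n 0 ω ≠ 0}

/-- The multiplier process `Z_{n,ξ}(f)`, defined on the product of the data space `Ω` and the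
multiplier space `Ξ`; the number of blocks is `⌊n / r_n⌋`. -/
noncomputable def multiplierProcess {d : ℕ} {Ω Ξ : Type*} [MeasurableSpace Ω] (P : Measure Ω)
    (X : ℕ → ℕ → Ω → State d) (r : ℕ → ℕ) (ξ : ℕ → Ξ → ℝ) (n : ℕ)
    (f : List (State d) → ℝ) (p : Ω × Ξ) : ℝ :=
  (1 / √(n * nonzeroProb P X n)) * ∑ j ∈ Finset.range (n / r n),
    ξ j p.2 * (f (block X r n j p.1) - ∫ ω, f (block X r n j ω) ∂P)

/-- `ℓ^∞(𝓕)`: the bounded real functions on `𝓕` with the supremum norm. -/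
abbrev LInf {d : ℕ} (𝓕 : Set (List (State d) → ℝ)) : Type :=
  lp (fun _ : 𝓕 => ℝ) ∞

/-- All sample paths of the multiplier processes are bounded functions on `𝓕`. -/
def HasBoundedPaths {d : ℕ} {Ω Ξ : Type*} [MeasurableSpace Ω] (P : Measure Ω)
    (X : ℕ → ℕ → Ω → State d) (r : ℕ → ℕ) (ξ : ℕ → Ξ → ℝ)
    (𝓕 : Set (List (State d) → ℝ)) : Prop :=
  ∀ (n : ℕ) (p : Ω × Ξ), Memℓp (fun f : 𝓕 => multiplierProcess P X r ξ n f p) ∞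

/-- The multiplier process as a map into `ℓ^∞(𝓕)`. -/
noncomputable def multiplierElement {d : ℕ} {Ω Ξ : Type*} [MeasurableSpace Ω] {P : Measure Ω}
    {X : ℕ → ℕ → Ω → State d} {r : ℕ → ℕ} {ξ : ℕ → Ξ → ℝ}
    {𝓕 : Set (List (State d) → ℝ)} (hb : HasBoundedPaths P X r ξ 𝓕) (n : ℕ) (p : Ω × Ξ) :
    LInf 𝓕 :=
  ⟨fun f : 𝓕 => multiplierProcess P X r ξ n f p, hb n p⟩

/-- `BL_1(V)`: functions bounded by `1` in absolute value and `1`-Lipschitz. -/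
def BL1 (V : Type*) [NormedAddCommGroup V] : Set (V → ℝ) :=
  {g | (∀ z, |g z| ≤ 1) ∧ ∀ z w, |g z - g w| ≤ ‖z - w‖}

/-- `sup_{g ∈ BL_1(V)} |E g(S) - E g(T)|` for `S` defined on `(A, μ)` and `T` defined on `(B, ν)`. -/
noncomputable def blDist {A B V : Type*} [MeasurableSpace A] [MeasurableSpace B]
    [NormedAddCommGroup V] (μ : Measure A) (S : A → V) (ν : Measure B) (T : B → V) : ℝ :=
  ⨆ g : BL1 V, |∫ a, g.1 (S a) ∂μ - ∫ b, g.1 (T b) ∂ν|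

/-- The outer expectation `E^* T` of a bounded, not necessarily measurable, function `T`. -/
noncomputable def outerExpectation {A : Type*} [MeasurableSpace A] (μ : Measure A)
    (T : A → ℝ) : ℝ :=
  sInf {c | ∃ U : A → ℝ, Measurable U ∧ Integrable U μ ∧ (∀ a, T a ≤ U a) ∧ c = ∫ a, U a ∂μ}

/-- Weak convergence in the sense of Hoffmann-Jørgensen of arbitrary maps `T n` to a tight
Borel random element `Z`. -/
structure WeaklyConverges {A B V : Type*} [MeasurableSpace A] [MeasurableSpace B]
    [NormedAddCommGroup V] (μ : Measure A) (T : ℕ → A → V) (ν : Measure B) (Z : B → V) : Prop where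
  borel_measurable : @Measurable B V _ (borel V) Z
  tight : ∀ ε : ℝ≥0∞, 0 < ε → ∃ K : Set V, IsCompact K ∧ ν {b | Z b ∉ K} ≤ ε
  tendsto : ∀ h : V →ᵇ ℝ,
    Tendsto (fun n => outerExpectation μ fun a => h (T n a)) atTop (𝓝 (∫ b, h (Z b) ∂ν))

/-- `𝓕` is totally bounded for some semi-metric `ρ` with
`lim_{δ ↓ 0} limsup_n sup_{ρ(f,g) < δ} E (f(Y_n) - g(Y_n))² / (r_n v_n) = 0`; the expectations and
suprema are taken in `[0, ∞]`. -/
def L2TotallyBounded {d : ℕ} {Ω : Type*} [MeasurableSpace Ω] (P : Measure Ω)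
    (X : ℕ → ℕ → Ω → State d) (r : ℕ → ℕ) (𝓕 : Set (List (State d) → ℝ)) : Prop :=
  ∃ ρ : PseudoMetricSpace 𝓕,
    (∀ ε : ℝ, 0 < ε → ∃ t : Finset 𝓕, ∀ f : 𝓕, ∃ g ∈ t, ρ.dist f g < ε) ∧
    Tendsto (fun δ : ℝ => limsup (fun n : ℕ =>
        ⨆ (f : 𝓕) (g : 𝓕) (_ : ρ.dist f g < δ),
          (∫⁻ ω, ENNReal.ofReal ((f.1 (block X r n 0 ω) - g.1 (block X r n 0 ω)) ^ 2) ∂P) /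
            ENNReal.ofReal (r n * nonzeroProb P X n)) atTop)
      (𝓝[>] 0) (𝓝 0)

/-- Convergence of the finite-dimensional distributions of the multiplier process to those of `Z`,
conditionally on the data, in probability; `E_ξ` integrates out the multiplier coordinate and
`ℝ^l` carries the maximum norm. -/
def ConditionalFidiConvergence {d : ℕ} {Ω Ξ Ω' : Type*} [MeasurableSpace Ω] [MeasurableSpace Ξ]
    [MeasurableSpace Ω'] (P : Measure Ω) (Q : Measure Ξ) (P' : Measure Ω')
    (X : ℕ → ℕ → Ω → State d) (r : ℕ → ℕ) (ξ : ℕ → Ξ → ℝ)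
    (𝓕 : Set (List (State d) → ℝ)) (Z : Ω' → LInf 𝓕) : Prop :=
  ∀ (l : ℕ) (f : Fin l → 𝓕),
    TendstoInMeasure P
      (fun n ω => blDist Q (fun x (k : Fin l) => multiplierProcess P X r ξ n (f k) (ω, x))
        P' (fun b (k : Fin l) => Z b (f k)))
      atTop (fun _ => (0 : ℝ))

end MultiplierBootstrap

/-! Tightness of `Z` reduces the claim to finitely many coordinates. A compact set carrying most of
the law of `Z` consists of functions uniformly close to step functions built from their values at
finitely many points (`exists_stepFunction_approx`). Let `φ` be the resulting continuous projection
and `D z = min 2 ‖z - φ z‖`; then `D (Z)` has small mean (`exists_integral_truncDist_lt`). For `g`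
in `BL1`, replacing `g` by `g ∘ φ` costs at most the mean of `D`, and `g ∘ φ` is a `BL1` function of
finitely many coordinates (`blDist_le_of_stepFunction`). The conditional fidi convergence controls
the middle term. Since `D` is bounded and continuous, unconditional weak convergence makes the outer
mean of `D` at the multiplier process small, and Fubini with Markov's inequality turns this into
smallness of the conditional mean off a set of small outer probability
(`measure_le_integral_section_le`). -/

namespace MultiplierBootstrap

/-! ### Compact sets in `ℓ^∞` and step functions -/

section FiniteApproximation

variable {ι : Type*} {l : ℕ}

/-- The bounded function on `ι` which is constant, with values `y`, on the cells of the finite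
partition given by `i`. -/
def stepFunction (i : ι → Fin l) : (Fin l → ℝ) →+ lp (fun _ : ι => ℝ) ∞ where
  toFun y := ⟨fun f => y (i f), memℓp_infty ⟨‖y‖, by
    rintro _ ⟨f, rfl⟩
    exact norm_le_pi_norm y (i f)⟩⟩
  map_zero' := rfl
  map_add' _ _ := rfl

@[simp]
lemma stepFunction_apply (i : ι → Fin l) (y : Fin l → ℝ) (f : ι) :
    stepFunction i y f = y (i f) := rfl

lemma norm_stepFunction_le (i : ι → Fin l) (y : Fin l → ℝ) : ‖stepFunction i y‖ ≤ ‖y‖ :=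
  lp.norm_le_of_forall_le (norm_nonneg y) fun f => norm_le_pi_norm y (i f)

lemma norm_sub_stepFunction_le (i : ι → Fin l) (y z : Fin l → ℝ) :
    ‖stepFunction i y - stepFunction i z‖ ≤ ‖y - z‖ := by
  rw [← map_sub]
  exact norm_stepFunction_le i _

lemma continuous_stepFunction (i : ι → Fin l) : Continuous (stepFunction i) :=
  (LipschitzWith.of_dist_le_mul (K := 1) fun y z => by
    simpa [dist_eq_norm] using norm_sub_stepFunction_le i y z).continuous

lemma abs_apply_le_norm (z : lp (fun _ : ι => ℝ) ∞) (f : ι) : |z f| ≤ ‖z‖ :=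
  lp.norm_apply_le_norm ENNReal.top_ne_zero z f

lemma continuous_eval (f : ι) : Continuous fun z : lp (fun _ : ι => ℝ) ∞ => z f :=
  (LipschitzWith.of_dist_le_mul (K := 1) fun y z => by
    simpa [dist_eq_norm, Real.dist_eq] using abs_apply_le_norm (y - z) f).continuous

/-- The functions in a compact subset of `ℓ^∞(ι)` are uniformly approximated by their values on a
finite set of points. -/
lemma exists_stepFunction_approx {K : Set (lp (fun _ : ι => ℝ) ∞)} (hK : IsCompact K) {ε : ℝ}
    (hε : 0 < ε) :
    ∃ (l : ℕ) (e : Fin l → ι) (i : ι → Fin l),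
      ∀ z ∈ K, ‖z - stepFunction i fun k => z (e k)‖ ≤ ε := by
  obtain ⟨t, ht, hKt⟩ := Metric.totallyBounded_iff.1 hK.totallyBounded (ε / 3) (by positivity)
  have := ht.fintype
  -- Transpose: an index becomes the vector of values of the net functions there. The range is
  -- bounded in a finite-dimensional space, hence totally bounded.
  let Φ : ι → t → ℝ := fun f z => z.1 f
  have hΦ : TotallyBounded (Set.range Φ) := by
    suffices Bornology.IsBounded (Set.range Φ) from
      this.isCompact_closure.totallyBounded.subset subset_closure
    refine isBounded_iff_forall_norm_le.2 ⟨∑ z : t, ‖z.1‖, ?_⟩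
    rintro _ ⟨f, rfl⟩
    refine (pi_norm_le_iff_of_nonneg (by positivity)).2 fun z => ?_
    exact (abs_apply_le_norm z.1 f).trans
      (Finset.single_le_sum (f := fun z : t => ‖z.1‖) (fun _ _ => norm_nonneg _)
        (Finset.mem_univ z))
  -- Centres are taken inside the range, so that each one comes from an index.
  obtain ⟨s, hs, hsf, hcov⟩ := totallyBounded_iff_subset.1 hΦ _
    (Metric.dist_mem_uniformity (show 0 < ε / 3 by positivity))
  have := hsf.to_subtype
  have hcell : ∀ f, ∃ y : s, dist (Φ f) y < ε / 3 := fun f => by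
    have := hcov (Set.mem_range_self f)
    simp only [Set.mem_iUnion] at this
    obtain ⟨y, hy, hfy⟩ := this
    exact ⟨⟨y, hy⟩, hfy⟩
  choose c hc using hcell
  choose p hp using fun y : s => hs y.2
  refine ⟨Nat.card s, fun k => p ((Finite.equivFin s).symm k), fun f => Finite.equivFin s (c f),
    fun z hz => lp.norm_le_of_forall_le hε.le fun f => ?_⟩
  obtain ⟨w, hw, hzw⟩ : ∃ w ∈ t, dist z w < ε / 3 := by simpa using hKt hz
  have h1 := abs_apply_le_norm (z - w) f
  have h2 := abs_apply_le_norm (z - w) (p (c f))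
  have h3 : |w f - w (p (c f))| < ε / 3 := by
    have := (dist_pi_lt_iff (by positivity)).1 (hc f) ⟨w, hw⟩
    rw [← hp (c f), Real.dist_eq] at this
    exact this
  rw [dist_eq_norm] at hzw
  simp only [lp.coeFn_sub, Pi.sub_apply, stepFunction_apply, Equiv.symm_apply_apply,
    Real.norm_eq_abs] at h1 h2 ⊢
  rw [abs_le] at h1 h2 ⊢
  rw [abs_lt] at h3
  constructor <;> linarith

end FiniteApproximation

/-! ### The bounded Lipschitz distance and its reduction to coordinates -/

section BoundedLipschitz

variable {V : Type*} [NormedAddCommGroup V]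

lemma continuous_of_mem_BL1 {g : V → ℝ} (hg : g ∈ BL1 V) : Continuous g :=
  (LipschitzWith.of_dist_le_mul (K := 1) fun y z => by
    simpa [dist_eq_norm, Real.dist_eq] using hg.2 y z).continuous

lemma abs_sub_le_min_of_mem_BL1 {g : V → ℝ} (hg : g ∈ BL1 V) (y z : V) :
    |g y - g z| ≤ min 2 ‖y - z‖ := by
  refine le_min ?_ (hg.2 y z)
  have h1 := abs_le.1 (hg.1 y)
  have h2 := abs_le.1 (hg.1 z)
  rw [abs_le]
  constructor <;> linarith

variable {A B : Type*} [MeasurableSpace A] [MeasurableSpace B]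

lemma abs_integral_le_one {μ : Measure A} [IsProbabilityMeasure μ] {g : A → ℝ}
    (hg : ∀ a, |g a| ≤ 1) : |∫ a, g a ∂μ| ≤ 1 := by
  simpa using norm_integral_le_of_norm_le_const (μ := μ) (f := g) (.of_forall hg)

lemma abs_integral_sub_le_blDist {μ : Measure A} [IsProbabilityMeasure μ] {ν : Measure B}
    [IsProbabilityMeasure ν] (S : A → V) (T : B → V) {g : V → ℝ} (hg : g ∈ BL1 V) :
    |∫ a, g (S a) ∂μ - ∫ b, g (T b) ∂ν| ≤ blDist μ S ν T := by
  refine le_ciSup (f := fun g : BL1 V => |∫ a, g.1 (S a) ∂μ - ∫ b, g.1 (T b) ∂ν|) ⟨2, ?_⟩ ⟨g, hg⟩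
  rintro _ ⟨g, rfl⟩
  have h1 := abs_le.1 (abs_integral_le_one (μ := μ) fun a => g.2.1 (S a))
  have h2 := abs_le.1 (abs_integral_le_one (μ := ν) fun b => g.2.1 (T b))
  rw [abs_le]
  constructor <;> linarith

lemma blDist_nonneg (μ : Measure A) (S : A → V) (ν : Measure B) (T : B → V) :
    0 ≤ blDist μ S ν T :=
  Real.iSup_nonneg fun _ => abs_nonneg _

lemma integrable_comp_of_bounded {μ : Measure A} [IsFiniteMeasure μ] {S : A → V}
    (hS : Measurable[_, borel V] S) {h : V → ℝ} (hc : Continuous h) {c : ℝ}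
    (hb : ∀ v, |h v| ≤ c) : Integrable (fun a => h (S a)) μ := by
  borelize V
  exact Integrable.of_bound (hc.measurable.comp hS).aestronglyMeasurable c
    (.of_forall fun a => hb _)

/-- The truncated distance `min(2, ‖z - φ z‖)`, as a bounded continuous function of `z`. -/
noncomputable def truncDist (φ : V → V) (hφ : Continuous φ) : V →ᵇ ℝ :=
  BoundedContinuousFunction.ofNormedAddCommGroup (fun z => min 2 ‖z - φ z‖)
    (by fun_prop) 2 fun z => by
      rw [Real.norm_eq_abs, abs_of_nonneg (by positivity)]
      exact min_le_left _ _

@[simp]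
lemma truncDist_apply (φ : V → V) (hφ : Continuous φ) (z : V) :
    truncDist φ hφ z = min 2 ‖z - φ z‖ := rfl

lemma abs_truncDist_le (φ : V → V) (hφ : Continuous φ) (z : V) : |truncDist φ hφ z| ≤ 2 := by
  rw [truncDist_apply, abs_of_nonneg (by positivity)]
  exact min_le_left _ _

/-- The bound does not depend on `g`, so it survives the supremum over `BL1`. -/
lemma abs_integral_sub_integral_le_truncDist {μ : Measure A} [IsProbabilityMeasure μ] {S : A → V}
    (hS : Measurable[_, borel V] S) {φ : V → V} (hφ : Continuous φ) {g : V → ℝ}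
    (hg : g ∈ BL1 V) :
    |∫ a, g (S a) ∂μ - ∫ a, g (φ (S a)) ∂μ| ≤ ∫ a, truncDist φ hφ (S a) ∂μ := by
  have hgc := continuous_of_mem_BL1 hg
  rw [← integral_sub (integrable_comp_of_bounded hS hgc hg.1)
    (integrable_comp_of_bounded (h := fun v => g (φ v)) hS (hgc.comp hφ) fun v => hg.1 (φ v))]
  exact norm_integral_le_of_norm_le (f := fun a => g (S a) - g (φ (S a)))
    (integrable_comp_of_bounded hS (truncDist φ hφ).continuous (abs_truncDist_le φ hφ))
    (.of_forall fun a => abs_sub_le_min_of_mem_BL1 hg _ _)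

/-- Comparison of the bounded Lipschitz distance on `ℓ^∞(ι)` with that of finitely many
coordinates. -/
lemma blDist_le_of_stepFunction {ι : Type*} {l : ℕ} (e : Fin l → ι) (i : ι → Fin l)
    (hφ : Continuous fun z : lp (fun _ : ι => ℝ) ∞ => stepFunction i fun k => z (e k))
    {μ : Measure A} [IsProbabilityMeasure μ] {ν : Measure B} [IsProbabilityMeasure ν]
    {S : A → lp (fun _ : ι => ℝ) ∞} {T : B → lp (fun _ : ι => ℝ) ∞}
    (hS : Measurable[_, borel _] S) (hT : Measurable[_, borel _] T) :
    blDist μ S ν T ≤ ∫ a, truncDist _ hφ (S a) ∂μ +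
      blDist μ (fun a k => S a (e k)) ν (fun b k => T b (e k)) +
      ∫ b, truncDist _ hφ (T b) ∂ν := by
  have : Nonempty (BL1 (lp (fun _ : ι => ℝ) ∞)) := ⟨⟨0, by simp [BL1]⟩⟩
  refine ciSup_le fun g => ?_
  have h1 := abs_le.1 (abs_integral_sub_integral_le_truncDist (μ := μ) hS hφ g.2)
  have h2 := abs_le.1 (abs_integral_sub_integral_le_truncDist (μ := ν) hT hφ g.2)
  have hg : (fun y => g.1 (stepFunction i y)) ∈ BL1 (Fin l → ℝ) :=
    ⟨fun y => g.2.1 _, fun y z => (g.2.2 _ _).trans (norm_sub_stepFunction_le i y z)⟩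
  have h3 := abs_le.1 (abs_integral_sub_le_blDist (μ := μ) (ν := ν)
    (fun a k => S a (e k)) (fun b k => T b (e k)) hg)
  rw [abs_le]
  constructor <;> linarith

end BoundedLipschitz

/-! ### Borel measurability in the multipliers, data fixed -/

section Measurability

/-- A linear combination of fixed functions with measurable real coefficients is Borel measurable as
a map into `ℓ^∞(ι)` as soon as its values are bounded functions. -/
lemma measurable_finite_combination {ι Ξ : Type*} [MeasurableSpace Ξ] {m : ℕ}
    (a : Fin m → ι → ℝ) {c : Ξ → Fin m → ℝ} (hc : Measurable c)
    (hmem : ∀ x, Memℓp (fun f => ∑ j, c x j * a j f) ∞) :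
    Measurable[_, borel (lp (fun _ : ι => ℝ) ∞)]
      fun x => (⟨fun f => ∑ j, c x j * a j f, hmem x⟩ : lp (fun _ : ι => ℝ) ∞) := by
  borelize ↥(lp (fun _ : ι => ℝ) ∞)
  let Ψ : (Fin m → ℝ) →ₗ[ℝ] ι → ℝ := Fintype.linearCombination ℝ a
  have hΨ : ∀ y, Ψ y = fun f => ∑ j, y j * a j f := fun y => by
    ext f
    simp [Ψ, Fintype.linearCombination_apply]
  -- Single functions `a j` may be unbounded, so the sum cannot be treated termwise. The coefficient
  -- vectors giving bounded functions form a finite-dimensional space, on which any linear map is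
  -- continuous.
  let L : Submodule ℝ (Fin m → ℝ) :=
    { carrier := {y | Memℓp (Ψ y) ∞}
      zero_mem' := by
        rw [Set.mem_ofPred_eq, map_zero]
        exact zero_memℓp
      add_mem' := fun {y z} hy hz => by
        rw [Set.mem_ofPred_eq, map_add] at *
        exact Memℓp.add hy hz
      smul_mem' := fun s y hy => by
        rw [Set.mem_ofPred_eq, map_smul] at *
        exact Memℓp.const_smul hy s }
  let T : L →ₗ[ℝ] lp (fun _ : ι => ℝ) ∞ :=
    { toFun := fun y => ⟨Ψ y, y.2⟩
      map_add' := fun y z => Subtype.ext (map_add Ψ y.1 z.1)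
      map_smul' := fun s y => Subtype.ext (map_smul Ψ s y.1) }
  have hL : ∀ x, c x ∈ L := fun x => by
    change Memℓp (Ψ (c x)) ∞
    rw [hΨ]
    exact hmem x
  convert T.continuous_of_finiteDimensional.measurable.comp (hc.subtype_mk (h := hL)) using 2 with x
  exact Subtype.ext (hΨ (c x)).symm

/-- For fixed data only finitely many real multipliers vary. This makes `E_ξ` of a continuous
bounded function a genuine integral, not the default value `0`. -/
lemma measurable_multiplierElement {d : ℕ} {Ω Ξ : Type*} [MeasurableSpace Ω] [MeasurableSpace Ξ]
    {P : Measure Ω} {X : ℕ → ℕ → Ω → State d} {r : ℕ → ℕ} {ξ : ℕ → Ξ → ℝ}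
    (hξ : ∀ j, Measurable (ξ j)) {𝓕 : Set (List (State d) → ℝ)}
    (hb : HasBoundedPaths P X r ξ 𝓕) (n : ℕ) (ω : Ω) :
    Measurable[_, borel (LInf 𝓕)] fun x => multiplierElement hb n (ω, x) := by
  have heq : ∀ (x : Ξ) (f : 𝓕), multiplierProcess P X r ξ n f (ω, x) =
      ∑ j : Fin (n / r n), ξ j x * ((1 / √(n * nonzeroProb P X n)) *
        (f.1 (block X r n j ω) - ∫ ω, f.1 (block X r n j ω) ∂P)) := fun x f => by
    rw [multiplierProcess, Finset.mul_sum, Finset.sum_range]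
    exact Finset.sum_congr rfl fun j _ => by ring
  have hmem : ∀ x, Memℓp (fun f : 𝓕 => ∑ j : Fin (n / r n), ξ j x *
      ((1 / √(n * nonzeroProb P X n)) *
        (f.1 (block X r n j ω) - ∫ ω, f.1 (block X r n j ω) ∂P))) ∞ := fun x => by
    simpa only [heq] using hb n (ω, x)
  convert measurable_finite_combination _ (measurable_pi_lambda _ fun j : Fin (n / r n) => hξ j)
    hmem using 2 with x
  exact Subtype.ext (funext (heq x))

end Measurability

/-! ### From outer expectation to conditional expectation -/

section OuterExpectation

variable {A B : Type*} [MeasurableSpace A] [MeasurableSpace B]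

/-- Markov's inequality for the conditional expectation, given the first coordinate, of a function
with small outer expectation. -/
lemma measure_le_integral_section_le {μ : Measure A} [IsProbabilityMeasure μ] {ν : Measure B}
    [IsProbabilityMeasure ν] {T : A × B → ℝ} (h0 : ∀ p, 0 ≤ T p) {b : ℝ} (hb : ∀ p, T p ≤ b)
    {c : ℝ} (hc : outerExpectation (μ.prod ν) T < c) {ε : ℝ} (hε : 0 < ε) :
    μ {a | ε ≤ ∫ x, T (a, x) ∂ν} ≤ ENNReal.ofReal (c / ε) := by
  have hne : {c | ∃ U : A × B → ℝ, Measurable U ∧ Integrable U (μ.prod ν) ∧ (∀ p, T p ≤ U p) ∧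
      c = ∫ p, U p ∂μ.prod ν}.Nonempty :=
    ⟨_, fun _ => b, measurable_const, integrable_const b, hb, rfl⟩
  obtain ⟨_, ⟨U, -, hUi, hTU, rfl⟩, hUc⟩ := exists_lt_of_csInf_lt hne hc
  have hU0 : ∀ a, 0 ≤ ∫ x, U (a, x) ∂ν := fun a =>
    integral_nonneg fun x => (h0 _).trans (hTU _)
  have hle : μ {a | ε ≤ ∫ x, T (a, x) ∂ν} ≤ μ {a | ε ≤ ∫ x, U (a, x) ∂ν} := by
    refine measure_mono_ae ?_
    filter_upwards [hUi.prod_right_ae] with a ha h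
    -- Only the majorant needs an integrable section: a nonmeasurable section of `T` has integral
    -- `0`, which is harmless as `U` is nonnegative.
    exact le_trans h (integral_mono_of_nonneg (.of_forall fun x => h0 _) ha
      (.of_forall fun x => hTU _))
  refine hle.trans ?_
  rw [← ofReal_measureReal]
  refine ENNReal.ofReal_le_ofReal ((le_div_iff₀' hε).2 ?_)
  refine (mul_meas_ge_le_integral_of_nonneg (.of_forall hU0) hUi.integral_prod_left ε).trans ?_
  rw [← integral_prod _ hUi]
  exact hUc.le

end OuterExpectation

/-- A tight random element of `ℓ^∞(ι)` is approximated in mean by its values at finitely many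
points. -/
lemma exists_integral_truncDist_lt {ι B : Type*} [MeasurableSpace B] {ν : Measure B}
    [IsProbabilityMeasure ν] {Z : B → lp (fun _ : ι => ℝ) ∞} (hZ : Measurable[_, borel _] Z)
    (htight : ∀ ε : ℝ≥0∞, 0 < ε → ∃ K, IsCompact K ∧ ν {b | Z b ∉ K} ≤ ε) {ε : ℝ} (hε : 0 < ε) :
    ∃ (l : ℕ) (e : Fin l → ι) (i : ι → Fin l)
      (hφ : Continuous fun z : lp (fun _ : ι => ℝ) ∞ => stepFunction i fun k => z (e k)),
      ∫ b, truncDist _ hφ (Z b) ∂ν < ε := by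
  -- Off `K` the truncated distance is at most `2`, costing `ε / 3`; on `K` it is at most `ε / 3`.
  obtain ⟨K, hK, hνK⟩ := htight (ENNReal.ofReal (ε / 6)) (by simpa using hε)
  obtain ⟨l, e, i, happ⟩ := exists_stepFunction_approx hK (show 0 < ε / 3 by positivity)
  have hφ : Continuous fun z : lp (fun _ : ι => ℝ) ∞ => stepFunction i fun k => z (e k) :=
    (continuous_stepFunction i).comp (continuous_pi fun k => continuous_eval (e k))
  refine ⟨l, e, i, hφ, ?_⟩
  have hmeas : MeasurableSet {b | Z b ∉ K} := by
    borelize ↥(lp (fun _ : ι => ℝ) ∞)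
    exact hZ hK.isClosed.measurableSet.compl
  have hreal : ν.real {b | Z b ∉ K} ≤ ε / 6 := ENNReal.toReal_le_of_le_ofReal (by positivity) hνK
  have hind : Integrable ({b | Z b ∉ K}.indicator fun _ => (2 : ℝ)) ν :=
    (integrable_const 2).indicator hmeas
  calc ∫ b, truncDist _ hφ (Z b) ∂ν
      ≤ ∫ b, (ε / 3 + {b | Z b ∉ K}.indicator (fun _ => (2 : ℝ)) b) ∂ν := by
        refine integral_mono
          (integrable_comp_of_bounded hZ (truncDist _ hφ).continuous (abs_truncDist_le _ hφ))
          ((integrable_const _).add hind) fun b => ?_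
        by_cases hb : Z b ∈ K
        · simpa [hb] using Or.inr (happ _ hb)
        · have : min 2 ‖Z b - stepFunction i fun k => Z b (e k)‖ ≤ 2 := min_le_left _ _
          simp only [truncDist_apply, Set.indicator, Set.mem_ofPred_eq, hb, not_false_eq_true,
            if_true]
          linarith
    _ = ε / 3 + ν.real {b | Z b ∉ K} * 2 := by
        rw [integral_add (integrable_const _) hind, integral_indicator_const _ hmeas]
        simp
    _ < ε := by linarith

end MultiplierBootstrap

/-! ### The main theorem -/

theorem theorem2p3 {d : ℕ} {Ω Ξ Ω' : Type*}
    [MeasurableSpace Ω] [MeasurableSpace Ξ] [MeasurableSpace Ω']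
    (P : Measure Ω) [IsProbabilityMeasure P]
    (Q : Measure Ξ) [IsProbabilityMeasure Q]
    (P' : Measure Ω') [IsProbabilityMeasure P']
    (X : ℕ → ℕ → Ω → MultiplierBootstrap.State d)
    (hX : MultiplierBootstrap.IsRowStationary P X)
    (r : ℕ → ℕ) (hr : ∀ n, 1 ≤ n → 1 ≤ r n ∧ r n ≤ n)
    (hv : ∀ n, 1 ≤ n → 0 < MultiplierBootstrap.nonzeroProb P X n)
    (ξ : ℕ → Ξ → ℝ) (hξ : MultiplierBootstrap.IsMultiplierSequence Q ξ)
    (𝓕 : Set (List (MultiplierBootstrap.State d) → ℝ))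
    (h𝓕 : ∀ f ∈ 𝓕, MultiplierBootstrap.IsClusterFunctional f)
    (hint : ∀ n, 1 ≤ n → ∀ f ∈ 𝓕,
      Integrable (fun ω => f (MultiplierBootstrap.block X r n 0 ω)) P)
    (hbdd : MultiplierBootstrap.HasBoundedPaths P X r ξ 𝓕)
    (Z : Ω' → MultiplierBootstrap.LInf 𝓕)
    (htb : MultiplierBootstrap.L2TotallyBounded P X r 𝓕)
    (hfidi : MultiplierBootstrap.ConditionalFidiConvergence P Q P' X r ξ 𝓕 Z)
    (hweak : MultiplierBootstrap.WeaklyConverges (P.prod Q)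
      (fun n p => MultiplierBootstrap.multiplierElement hbdd n p) P' Z) :
    TendstoInMeasure P
      (fun n ω => MultiplierBootstrap.blDist Q
        (fun x => MultiplierBootstrap.multiplierElement hbdd n (ω, x)) P' Z)
      atTop (fun _ => (0 : ℝ)) := by
  rw [tendstoInMeasure_iff_dist]
  intro ε hε
  rw [ENNReal.tendsto_nhds_zero]
  intro η hη
  obtain ⟨τ, hτ, hτη⟩ : ∃ τ : ℝ, 0 < τ ∧ ENNReal.ofReal τ ≤ η / 2 := by
    obtain ⟨τ, hτ, hτη⟩ := ENNReal.lt_iff_exists_nnreal_btwn.1 (ENNReal.half_pos hη.ne')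
    exact ⟨τ, by simpa using hτ, by simpa using hτη.le⟩
  have hε3 : 0 < ε / 3 := by positivity
  -- The bound `ε / 3` serves the term of `Z`; the bound `τ * (ε / 3)` leaves probability `τ` after
  -- Markov's inequality at level `ε / 3`.
  obtain ⟨l, e, i, hφ, hlt⟩ := MultiplierBootstrap.exists_integral_truncDist_lt
    hweak.borel_measurable hweak.tight (lt_min hε3 (mul_pos hτ hε3))
  have hfd := (ENNReal.tendsto_nhds_zero.1
    (tendstoInMeasure_iff_dist.1 (hfidi l e) (ε / 3) hε3)) (η / 2) (ENNReal.half_pos hη.ne')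
  have hout := (hweak.tendsto (MultiplierBootstrap.truncDist _ hφ)).eventually_lt_const
    (hlt.trans_le (min_le_right _ _))
  filter_upwards [hfd, hout] with n hn hn'
  have hsec := MultiplierBootstrap.measure_le_integral_section_le
    (fun p => le_min zero_le_two (norm_nonneg _))
    (fun p => min_le_left _ _) hn' hε3
  rw [mul_div_cancel_right₀ _ hε3.ne'] at hsec
  refine (measure_mono fun ω hω => ?_).trans ((measure_union_le _ _).trans
    ((add_le_add (hsec.trans hτη) hn).trans_eq (ENNReal.add_halves η)))
  simp only [Set.mem_ofPred_eq, Set.mem_union, Real.dist_eq, sub_zero,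
    abs_of_nonneg (MultiplierBootstrap.blDist_nonneg _ _ _ _)] at hω ⊢
  -- Off both exceptional sets each of the three terms is below `ε / 3`.
  by_contra! hcon
  have hle := MultiplierBootstrap.blDist_le_of_stepFunction e i hφ (μ := Q) (ν := P')
    (MultiplierBootstrap.measurable_multiplierElement hξ.measurable hbdd n ω)
    hweak.borel_measurable
  have h3 := hlt.trans_le (min_le_left _ _)
  have h1 : ∫ x, MultiplierBootstrap.truncDist _ hφ
      (MultiplierBootstrap.multiplierElement hbdd n (ω, x)) ∂Q < ε / 3 := hcon.1
  have h2 : MultiplierBootstrap.blDist Q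
      (fun x k => MultiplierBootstrap.multiplierElement hbdd n (ω, x) (e k)) P'
      (fun b k => Z b (e k)) < ε / 3 := hcon.2
  linarith
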